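/- **Proposition 5.3 (invariance of the manifold).** Let $\mathcal O\subset\mathbb R^d$ be open (in particular, $\mathcal O$ may be a bounded domain with smooth boundary), let $a\in\mathbb R$, let $n>\tfrac12$ be real (for instance $n\in\mathbb N$, $n\ge 1$), and read $u^{2n-1}$ as $|u|^{2n-2}u$, which is the ordinary power for $n\in\mathbb N$. Put $$\mathcal H=L^2(\mathcal O),\quad \mathcal V=H^1_0(\mathcal O)\cap H^2(\mathcal O),\quad \mathcal E=H^1_0(\mathcal O)\cap H^2(\mathcal O)\cap H^4(\mathcal O),\quad \mathcal M=\{u\in\mathcal H:\ |u|_{\mathcal H}^2=1\},$$ all functions being real-valued, $\mathcal V$ and $\mathcal E$ carrying the norms of $H^2(\mathcal O)$ and $H^4(\mathcal O)$, and for $u,h\in\mathcal H$ let $\pi_u(h)=h-\langle h,u\rangle_{\mathcal H}\,u$. Let $T\in(0,\infty]$ and let $u:[0,T)\to\mathcal V$ be a solution of $$\frac{\partial u}{\partial t}=\pi_u\bigl(-\Delta^2u+2\Delta u-au-u^{2n-1}\bigr),\qquad u(0)=u_0,$$ that is: $u\in C([0,T);\mathcal V)$; for every $t\in(0,T)$ one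 has $u\in L^2(0,t;\mathcal E)$ and $u^{2n-1}\in L^1(0,t;\mathcal H)$ (so that the right-hand side is a well-defined locally integrable $\mathcal H$-valued function of time); $u(0)=u_0$; and the equation holds on $(0,T)$ with $\partial u/\partial t$ the weak time derivative of $u$ as an $\mathcal H$-valued function. If $u_0\in\mathcal M$, i.e. $|u_0|_{\mathcal H}^2=1$, then $u(t)\in\mathcal M$, i.e. $|u(t)|_{\mathcal H}^2=1$, for all $t\in[0,T)$. -/

import Mathlib

open MeasureTheory Filter Topology Set
open scoped ContDiff

noncomputable section

namespace SwiftHohenberg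

/-- Infinitely differentiable functions with compact support contained in `O`. -/
def IsTestFunction {X : Type*} [NormedAddCommGroup X] [NormedSpace ℝ X]
    (O : Set X) (φ : X → ℝ) : Prop :=
  ContDiff ℝ ∞ φ ∧ HasCompactSupport φ ∧ tsupport φ ⊆ O

variable {d : ℕ} (O : Set (EuclideanSpace ℝ (Fin d)))

/-- The real Hilbert space `L²(O)` with respect to Lebesgue measure. -/
abbrev L2 : Type := Lp ℝ 2 (volume.restrict O)

/-- The classical iterated partial derivative `∂_{I 0} ⋯ ∂_{I (k-1)} φ`. -/
def partialDeriv {k : ℕ} (I : Fin k → Fin d) (φ : EuclideanSpace ℝ (Fin d) → ℝ) :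
    EuclideanSpace ℝ (Fin d) → ℝ :=
  fun x => iteratedFDeriv ℝ k φ x (fun j => EuclideanSpace.single (I j) (1 : ℝ))

/-- `v ∈ L²(O)` is the weak partial derivative `∂_{I 0} ⋯ ∂_{I (k-1)} u` of `u ∈ L²(O)`. -/
def IsWeakDeriv {k : ℕ} (I : Fin k → Fin d) (u v : L2 O) : Prop :=
  ∀ φ : EuclideanSpace ℝ (Fin d) → ℝ, IsTestFunction O φ →
    ∫ x in O, u x * partialDeriv I φ x = (-1) ^ k * ∫ x in O, v x * φ x

open Classical in
/-- The weak partial derivative along `I` as an element of `L²(O)`. For open `O` it is unique when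
it exists; the value is `0` when there is none in `L²(O)`, a case which never occurs below,
where it is only used for functions of the appropriate Sobolev space. -/
def weakDeriv {k : ℕ} (I : Fin k → Fin d) (u : L2 O) : L2 O :=
  if h : ∃ v, IsWeakDeriv O I u v then h.choose else 0

/-- The Sobolev space `H^k(O)`: all weak derivatives of order at most `k` exist in `L²(O)`. -/
def sobolev (k : ℕ) : Set (L2 O) :=
  {u | ∀ j ≤ k, ∀ I : Fin j → Fin d, ∃ v, IsWeakDeriv O I u v}

/-- The norm of `H^k(O)`: the square root of the sum of the squared `L²` norms of the full
derivative tensors of order at most `k`. -/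
def sobolevNorm (k : ℕ) (u : L2 O) : ℝ :=
  Real.sqrt (∑ j ∈ Finset.range (k + 1), ∑ I : Fin j → Fin d, ‖weakDeriv O I u‖ ^ 2)

/-- `H¹₀(O)`: the closure of the test functions in `H¹(O)`. -/
def sobolevZero : Set (L2 O) :=
  {u | u ∈ sobolev O 1 ∧ ∀ ε > 0, ∃ (φ : EuclideanSpace ℝ (Fin d) → ℝ) (f : L2 O),
    IsTestFunction O φ ∧ f =ᵐ[volume.restrict O] φ ∧ sobolevNorm O 1 (u - f) < ε}

/-- `V = H¹₀(O) ∩ H²(O)`. -/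
def spaceV : Set (L2 O) := sobolevZero O ∩ sobolev O 2

/-- `E = H¹₀(O) ∩ H²(O) ∩ H⁴(O)`. -/
def spaceE : Set (L2 O) := sobolevZero O ∩ sobolev O 2 ∩ sobolev O 4

/-- The weak Laplacian `Δ u = ∑ i, ∂_i ∂_i u`. -/
def laplacian (u : L2 O) : L2 O := ∑ i : Fin d, weakDeriv O ![i, i] u

/-- The bi-Laplacian `Δ² u = ∑ i, ∑ j, ∂_i ∂_i ∂_j ∂_j u`. -/
def bilaplacian (u : L2 O) : L2 O := ∑ i : Fin d, ∑ j : Fin d, weakDeriv O ![i, i, j, j] u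

/-- The odd power `s^(2n-1)` for a real exponent parameter `n > 1/2`, that is `|s|^(2n-2) s`. -/
def oddPow (n s : ℝ) : ℝ := |s| ^ (2 * n - 2) * s

/-- For a natural number `n ≥ 1` this is the ordinary power. -/
theorem oddPow_natCast (n : ℕ) (hn : 1 ≤ n) (s : ℝ) : oddPow n s = s ^ (2 * n - 1) := by
  obtain ⟨m, rfl⟩ := Nat.exists_eq_add_of_le' hn
  have h1 : (2 * ((m + 1 : ℕ) : ℝ) - 2) = ((2 * m : ℕ) : ℝ) := by push_cast; ring
  have h2 : 2 * (m + 1) - 1 = 2 * m + 1 := by omega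
  rw [oddPow, h1, Real.rpow_natCast, h2, pow_succ, pow_mul, sq_abs, ← pow_mul]

/-- `u^(2n-1)` belongs to `L²(O)`. -/
def PowMem (n : ℝ) (u : L2 O) : Prop :=
  MemLp (fun x => oddPow n (u x)) 2 (volume.restrict O)

open Classical in
/-- `u^(2n-1)` as an element of `L²(O)`, used only when `PowMem O n u`. -/
def powL2 (n : ℝ) (u : L2 O) : L2 O :=
  if h : PowMem O n u then h.toLp (fun x => oddPow n (u x)) else 0

/-- The unconstrained right-hand side `-Δ² u + 2 Δ u - a u - u^(2n-1)`. -/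
def drift (a n : ℝ) (u : L2 O) : L2 O :=
  -bilaplacian O u + (2 : ℝ) • laplacian O u - a • u - powL2 O n u

/-- The Hilbert manifold `M`, the unit sphere of `L²(O)`. -/
def manifold : Set (L2 O) := {u | ‖u‖ ^ 2 = 1}

/-- The projection `π_u h = h - ⟨h, u⟩ u`. -/
def proj (u h : L2 O) : L2 O := h - (inner ℝ h u : ℝ) • u

/-- `u : [0,T) → V` solves `∂u/∂t = π_u(-Δ² u + 2 Δ u - a u - u^(2n-1))`, `u(0) = u₀`.
Here `T` may be `∞`, and only the values of `u` on `[0,T)` are used. -/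
structure IsSolution (a n : ℝ) (T : EReal) (u₀ : L2 O) (u : ℝ → L2 O) : Prop where
  /-- `u(t) ∈ V` for all `t ∈ [0,T)`. -/
  mem_V : ∀ t : ℝ, 0 ≤ t → (t : EReal) < T → u t ∈ spaceV O
  /-- `u` is continuous on `[0,T)` with values in `V`, for the norm of `H²(O)`. -/
  continuous_V : ∀ t : ℝ, 0 ≤ t → (t : EReal) < T →
    Tendsto (fun s => sobolevNorm O 2 (u s - u t)) (𝓝[{s : ℝ | 0 ≤ s ∧ (s : EReal) < T}] t) (𝓝 0)
  /-- `u ∈ L²(0,t;E)` for all `t < T`: almost every value is in `E` ... -/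
  mem_E : ∀ᵐ t : ℝ, 0 < t → (t : EReal) < T → u t ∈ spaceE O
  /-- ... and all spatial derivatives of order at most `4` are in `L²(0,t;L²(O))`. -/
  memLp_E : ∀ t : ℝ, 0 < t → (t : EReal) < T → ∀ j ≤ 4, ∀ I : Fin j → Fin d,
    MemLp (fun s => weakDeriv O I (u s)) 2 (volume.restrict (Ioo 0 t))
  /-- The nonlinear term of the equation takes values in `L²(O)` ... -/
  pow_mem : ∀ᵐ t : ℝ, 0 < t → (t : EReal) < T → PowMem O n (u t)
  /-- ... and is Bochner integrable on `(0,t)`, so that the right-hand side of the equation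
  is a well-defined `L²(O)`-valued distribution in time. -/
  pow_integrable : ∀ t : ℝ, 0 < t → (t : EReal) < T →
    IntegrableOn (fun s => powL2 O n (u s)) (Ioo 0 t)
  /-- The initial condition. -/
  initial : u 0 = u₀
  /-- The equation, with the weak time derivative of `u` as an `L²(O)`-valued function. -/
  equation : ∀ φ : ℝ → ℝ, IsTestFunction {t : ℝ | 0 < t ∧ (t : EReal) < T} φ →
    ∫ t in {t : ℝ | 0 < t ∧ (t : EReal) < T}, deriv φ t • u t =
      -∫ t in {t : ℝ | 0 < t ∧ (t : EReal) < T}, φ t • proj O (u t) (drift O a n (u t))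

end SwiftHohenberg

end

/-!
Write `f` for the unconstrained right-hand side along the solution `u`, and `k = ⟪f, u⟫`. The
projected equation is `u' = f - k u`, so formally `(‖u‖² - 1)' = 2 ⟪u, f - k u⟫ = -2 k (‖u‖² - 1)`,
a homogeneous linear equation for `‖u‖² - 1`. Since `‖u‖² - 1` vanishes at time `0` and `k` is
locally integrable, it vanishes identically.

Two points make this rigorous. First, the equation is only weak in time, and `u` is not assumed
differentiable anywhere. As the `H²` norm dominates the `L²` norm (`norm_le_sobolevNorm`), `u` is
continuous in `L²`, and the Sobolev and power integrability assumptions make `f`, hence `f - k u`,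
integrable on `(0, t)` for `t < T`. Testing with smooth approximations of the indicator of
an interval (`sub_eq_integral_of_weakDeriv`) gives the integrated equation
`u t = u 0 + ∫ r in 0..t, (f r - k r • u r)` (`IsSolution.eq_add_integral`). Second, `k` is merely
integrable, so the linear equation holds almost everywhere; the function
`exp (2 ∫ k) (‖u‖² - 1)` is absolutely continuous with almost everywhere vanishing derivative, hence
constant (`norm_eq_one_of_eq_integral_tangential`).
-/

open MeasureTheory Filter Topology Set
open scoped ContDiff

/-! ### Absolutely continuous functions -/

/-- Absolute continuity passes to a function whose increments are controlled by those of an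
absolutely continuous function, possibly with values in another space. -/
theorem AbsolutelyContinuousOnInterval.of_dist_le {X Y : Type*} [PseudoMetricSpace X]
    [PseudoMetricSpace Y] {f : ℝ → X} {g : ℝ → Y} {a b C : ℝ}
    (hg : AbsolutelyContinuousOnInterval g a b)
    (h : ∀ x ∈ uIcc a b, ∀ y ∈ uIcc a b, dist (f x) (f y) ≤ C * dist (g x) (g y)) :
    AbsolutelyContinuousOnInterval f a b := by
  unfold AbsolutelyContinuousOnInterval at hg ⊢
  refine squeeze_zero' (Eventually.of_forall fun _ => Finset.sum_nonneg fun _ _ => dist_nonneg)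
    ?_ (by simpa using hg.const_mul C)
  rw [eventually_inf_principal]
  filter_upwards with E hE
  rw [Finset.mul_sum]
  exact Finset.sum_le_sum fun i hi => h _ (hE.1 i hi).1 _ (hE.1 i hi).2

theorem AbsolutelyContinuousOnInterval.rexp {f : ℝ → ℝ} {a b : ℝ}
    (hf : AbsolutelyContinuousOnInterval f a b) :
    AbsolutelyContinuousOnInterval (fun x => Real.exp (f x)) a b := by
  obtain ⟨C, hC⟩ := hf.exists_bound
  obtain ⟨K, hK⟩ := (Real.contDiff_exp (n := 1)).contDiffOn.exists_lipschitzOnWith (by decide)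
    (convex_closedBall (0 : ℝ) C) (isCompact_closedBall _ _)
  refine hf.of_dist_le (C := K) fun x hx y hy => ?_
  exact hK.dist_le_mul _ (by simpa using hC x hx) _ (by simpa using hC y hy)

theorem IntervalIntegrable.absolutelyContinuousOnInterval_norm_add_integral {E : Type*}
    [NormedAddCommGroup E] [NormedSpace ℝ E] {g : ℝ → E} {a b : ℝ}
    (hg : IntervalIntegrable g volume a b) (c : E) :
    AbsolutelyContinuousOnInterval (fun r => ‖c + ∫ x in a..r, g x‖) a b := by
  refine (hg.norm.absolutelyContinuousOnInterval_intervalIntegral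
    (c := a) (by simp)).of_dist_le (C := 1) fun x hx y hy => ?_
  have hax : IntervalIntegrable g volume a x := hg.mono_set (uIcc_subset_uIcc_left hx)
  have hay : IntervalIntegrable g volume a y := hg.mono_set (uIcc_subset_uIcc_left hy)
  rw [one_mul, Real.dist_eq, Real.dist_eq,
    intervalIntegral.integral_interval_sub_left hax.norm hay.norm]
  refine (abs_norm_sub_norm_le _ _).trans ?_
  rw [add_sub_add_left_eq_sub, intervalIntegral.integral_interval_sub_left hax hay]
  exact intervalIntegral.norm_integral_le_abs_integral_norm

/-! ### Tangential integral equations on the unit sphere -/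

section UnitSphere

variable {H : Type*} [NormedAddCommGroup H] [InnerProductSpace ℝ H] [CompleteSpace H]

/-- A continuous curve which solves `u' = f - ⟪f, u⟫ u` in integrated form, with `f` integrable and
`‖u 0‖ = 1`, stays on the unit sphere. With `k = ⟪f, u⟫` one has `(‖u‖² - 1)' = -2 k (‖u‖² - 1)`
almost everywhere, so that `exp (2 ∫ k) (‖u‖² - 1)` is absolutely continuous with derivative
zero. -/
theorem norm_eq_one_of_eq_integral_tangential {u f : ℝ → H} {t : ℝ} (ht : 0 ≤ t)
    (hu : ContinuousOn u (Icc 0 t)) (hf : IntervalIntegrable f volume 0 t)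
    (h : ∀ r ∈ Icc 0 t, u r = u 0 + ∫ x in 0..r, (f x - (inner ℝ (f x) (u x) : ℝ) • u x))
    (h0 : ‖u 0‖ = 1) : ‖u t‖ = 1 := by
  have hI : uIcc 0 t = Icc 0 t := uIcc_of_le ht
  have hk : IntervalIntegrable (fun x => (inner ℝ (f x) (u x) : ℝ)) volume 0 t := by
    obtain ⟨C, hC⟩ := isCompact_Icc.exists_bound_of_continuousOn hu
    rw [intervalIntegrable_iff_integrableOn_Icc_of_le ht] at hf ⊢
    refine (hf.norm.const_mul C).mono'
      (hf.aestronglyMeasurable.inner (hu.aestronglyMeasurable measurableSet_Icc)) ?_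
    filter_upwards [ae_restrict_mem measurableSet_Icc] with x hx
    refine (norm_inner_le_norm _ _).trans ?_
    rw [mul_comm]
    exact mul_le_mul_of_nonneg_right (hC x hx) (norm_nonneg _)
  have hg : IntervalIntegrable (fun x => f x - (inner ℝ (f x) (u x) : ℝ) • u x) volume 0 t :=
    hf.sub (hk.smul_continuousOn (hI ▸ hu))
  set k : ℝ → ℝ := fun x => inner ℝ (f x) (u x) with hkdef
  -- `v` is defined on the whole line, so its two-sided derivative also makes sense at the endpoints.
  set v : ℝ → H := fun r => u 0 + ∫ x in 0..r, (f x - k x • u x) with hv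
  have huv : ∀ r ∈ Icc 0 t, u r = v r := h
  have hvn : AbsolutelyContinuousOnInterval (fun r => ‖v r‖) 0 t :=
    hg.absolutelyContinuousOnInterval_norm_add_integral (u 0)
  have hone : AbsolutelyContinuousOnInterval (fun _ : ℝ => (1 : ℝ)) 0 t :=
    contDiffOn_const.absolutelyContinuousOnInterval
  have hK : AbsolutelyContinuousOnInterval (fun r => ∫ x in 0..r, k x) 0 t :=
    hk.absolutelyContinuousOnInterval_intervalIntegral (by simp)
  have hz : AbsolutelyContinuousOnInterval
      (fun r => Real.exp (2 * ∫ x in 0..r, k x) * (‖v r‖ * ‖v r‖ - 1)) 0 t :=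
    (hK.const_mul 2).rexp.fun_mul ((hvn.fun_mul hvn).fun_sub hone)
  have hz0 : ∀ᵐ r, r ∈ uIcc 0 t → HasDerivAt
      (fun r => Real.exp (2 * ∫ x in 0..r, k x) * (‖v r‖ * ‖v r‖ - 1)) 0 r := by
    filter_upwards [hg.ae_hasDerivAt_integral, hk.ae_hasDerivAt_integral] with r h1 h2 hr
    have d1 : HasDerivAt v (f r - k r • u r) r := (h1 hr 0 (by simp)).const_add (u 0)
    have d2 := ((h2 hr 0 (by simp)).const_mul 2).exp
    have d3 : HasDerivAt (fun r => ‖v r‖ * ‖v r‖ - 1)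
        (inner ℝ (v r) (f r - k r • u r) + inner ℝ (f r - k r • u r) (v r)) r := by
      simpa only [← real_inner_self_eq_norm_mul_norm] using (d1.inner ℝ d1).sub_const 1
    refine (d2.mul d3).congr_deriv ?_
    have e : u r = v r := huv r (hI ▸ hr)
    simp only [hkdef, e, inner_sub_right, inner_sub_left, inner_smul_right, inner_smul_left,
      real_inner_self_eq_norm_mul_norm, real_inner_comm (f r) (v r), RCLike.conj_to_real]
    ring
  obtain ⟨C, hC⟩ := hz.const_of_ae_hasDerivAt_zero hz0
  have e0 := hC 0 (by simp)
  have e1 := hC t (by simp)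
  have v0 : ‖v 0‖ = 1 := by simp [hv, h0]
  rw [← e0, v0] at e1
  simp only [mul_one, sub_self, mul_zero, mul_eq_zero, Real.exp_ne_zero, false_or] at e1
  rw [huv t (by simp [ht])]
  nlinarith [norm_nonneg (v t)]

end UnitSphere

/-! ### Weak time derivatives of continuous vector-valued functions -/

section WeakDerivative

variable {E : Type*} [NormedAddCommGroup E] [NormedSpace ℝ E]

theorem hasDerivAt_smoothTransition_rescaled (s ε r : ℝ) :
    HasDerivAt (fun r => Real.smoothTransition ((r - s) / ε))
      (ε⁻¹ * deriv Real.smoothTransition ((r - s) / ε)) r := by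
  have h1 : HasDerivAt Real.smoothTransition (deriv Real.smoothTransition ((r - s) / ε))
      ((r - s) / ε) :=
    ((Real.smoothTransition.contDiff (n := 1)).differentiable (by simp) _).hasDerivAt
  have h2 : HasDerivAt (fun r => (r - s) / ε) (1 / ε) r :=
    ((hasDerivAt_id r).sub_const s).div_const ε
  refine (h1.comp r h2).congr_deriv ?_
  rw [one_div, mul_comm]

theorem deriv_smoothTransition_eq_zero {x : ℝ} (hx : x ∉ Icc (0 : ℝ) 1) :
    deriv Real.smoothTransition x = 0 := by
  rw [mem_Icc, not_and_or, not_le, not_le] at hx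
  rcases hx with hx | hx
  · have : Real.smoothTransition =ᶠ[𝓝 x] fun _ => 0 := by
      filter_upwards [Iio_mem_nhds hx] with y hy using Real.smoothTransition.zero_of_nonpos hy.le
    rw [this.deriv_eq, deriv_const]
  · have : Real.smoothTransition =ᶠ[𝓝 x] fun _ => 1 := by
      filter_upwards [Ioi_mem_nhds hx] with y hy using Real.smoothTransition.one_of_one_le hy.le
    rw [this.deriv_eq, deriv_const]

theorem continuous_deriv_smoothTransition : Continuous (deriv Real.smoothTransition) :=
  (Real.smoothTransition.contDiff (n := 1)).continuous_deriv le_rfl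

theorem integral_deriv_smoothTransition : ∫ x in (0 : ℝ)..1, deriv Real.smoothTransition x = 1 := by
  rw [intervalIntegral.integral_deriv_eq_sub
    (fun x _ => (Real.smoothTransition.contDiff (n := 1)).differentiable (by simp) x)
    (continuous_deriv_smoothTransition.intervalIntegrable _ _)]
  simp

/-- The derivative of the smooth step `r ↦ smoothTransition ((r - s) / ε)`: a kernel of integral
one supported in the one-sided interval `[s, s + ε]`. -/
noncomputable def mollifier (s ε r : ℝ) : ℝ := ε⁻¹ * deriv Real.smoothTransition ((r - s) / ε)

theorem mollifier_eq_zero {s ε r : ℝ} (hε : 0 < ε) (hr : r ∉ Icc s (s + ε)) :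
    mollifier s ε r = 0 := by
  rw [mollifier, deriv_smoothTransition_eq_zero, mul_zero]
  contrapose! hr
  rw [mem_Icc, le_div_iff₀ hε, div_le_one hε] at hr
  constructor <;> linarith [hr.1, hr.2]

theorem continuous_mollifier (s ε : ℝ) : Continuous (mollifier s ε) :=
  continuous_const.mul (continuous_deriv_smoothTransition.comp
    ((continuous_id.sub continuous_const).div_const ε))

theorem integrableOn_mollifier_smul {u : ℝ → E} {S : Set ℝ} {s ε : ℝ} (hε : 0 < ε)
    (hu : ContinuousOn u (Icc s (s + ε))) :
    IntegrableOn (fun r => mollifier s ε r • u r) S :=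
  (((continuous_mollifier s ε).continuousOn.smul hu).integrableOn_Icc
    |>.integrable_of_forall_notMem_eq_zero fun r hr => by
      rw [Pi.smul_apply', mollifier_eq_zero hε hr, zero_smul]).integrableOn

/-- Only continuity of `u` to the right of `s` enters, since the kernel is one-sided. -/
theorem tendsto_setIntegral_mollifier_smul {u : ℝ → E} {S : Set ℝ} {s δ : ℝ}
    (hδ : 0 < δ) (hS : Icc s (s + δ) ⊆ S) (hu : ContinuousOn u (Icc s (s + δ))) [CompleteSpace E] :
    Tendsto (fun ε => ∫ r in S, mollifier s ε r • u r) (𝓝[>] 0) (𝓝 (u s)) := by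
  -- Substitute `r = s + ε x`.
  have key : ∀ᶠ ε in 𝓝[>] (0 : ℝ), ∫ r in S, mollifier s ε r • u r
      = ∫ x in (0 : ℝ)..1, deriv Real.smoothTransition x • u (s + ε * x) := by
    filter_upwards [Ioo_mem_nhdsGT hδ] with ε hε
    have hsub : Icc s (s + ε) ⊆ S := (Icc_subset_Icc_right (by linarith [hε.2])).trans hS
    have hz : ∀ r, r ∉ Icc s (s + ε) → mollifier s ε r • u r = 0 := fun r hr => by
      rw [mollifier_eq_zero hε.1 hr, zero_smul]
    rw [setIntegral_eq_integral_of_forall_compl_eq_zero fun r hr => hz r fun h => hr (hsub h),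
      ← setIntegral_eq_integral_of_forall_compl_eq_zero hz, integral_Icc_eq_integral_Ioc,
      ← intervalIntegral.integral_of_le (by linarith [hε.1])]
    have hcv := intervalIntegral.smul_integral_comp_add_mul
      (fun r => mollifier s ε r • u r) (a := 0) (b := 1) ε s
    rw [mul_zero, add_zero, mul_one] at hcv
    rw [← hcv, ← intervalIntegral.integral_smul]
    refine intervalIntegral.integral_congr fun x _ => ?_
    simp only [mollifier, add_sub_cancel_left, mul_div_cancel_left₀ x hε.1.ne', smul_smul]
    rw [mul_inv_cancel_left₀ hε.1.ne']
  refine Tendsto.congr' (key.mono fun _ h => h.symm) ?_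
  have hlim : u s = ∫ x in (0 : ℝ)..1, deriv Real.smoothTransition x • u s := by
    rw [intervalIntegral.integral_smul_const, integral_deriv_smoothTransition, one_smul]
  rw [hlim]
  obtain ⟨C, hC⟩ := isCompact_Icc.exists_bound_of_continuousOn hu
  have hmap : ∀ ε ∈ Ioo 0 δ, MapsTo (fun x => s + ε * x) (Icc (0 : ℝ) 1) (Icc s (s + δ)) := by
    intro ε hε x hx
    constructor <;> nlinarith [hε.1, hε.2, hx.1, hx.2]
  refine intervalIntegral.tendsto_integral_filter_of_dominated_convergence
    (fun x => |deriv Real.smoothTransition x| * C) ?_ ?_ ?_ ?_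
  · filter_upwards [Ioo_mem_nhdsGT hδ] with ε hε
    rw [uIoc_of_le zero_le_one]
    have : ContinuousOn (fun x => deriv Real.smoothTransition x • u (s + ε * x)) (Icc 0 1) :=
      continuous_deriv_smoothTransition.continuousOn.smul
        (hu.comp (by fun_prop) (hmap ε hε))
    exact (this.mono Ioc_subset_Icc_self).aestronglyMeasurable measurableSet_Ioc
  · filter_upwards [Ioo_mem_nhdsGT hδ] with ε hε
    filter_upwards with x hx
    rw [uIoc_of_le zero_le_one] at hx
    rw [norm_smul, Real.norm_eq_abs]
    exact mul_le_mul_of_nonneg_left (hC _ (hmap ε hε (Ioc_subset_Icc_self hx))) (abs_nonneg _)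
  · exact (continuous_deriv_smoothTransition.abs.mul continuous_const).intervalIntegrable _ _
  · filter_upwards with x hx
    rw [uIoc_of_le zero_le_one] at hx
    refine Tendsto.const_smul ?_ _
    refine (hu s (by simp [hδ.le])).tendsto.comp (tendsto_nhdsWithin_iff.2 ⟨?_, ?_⟩)
    · have : Continuous fun ε : ℝ => s + ε * x := by fun_prop
      simpa using (this.tendsto 0).mono_left nhdsWithin_le_nhds
    · filter_upwards [Ioo_mem_nhdsGT hδ] with ε hε
      exact hmap ε hε (Ioc_subset_Icc_self hx)

/-- A difference of two smooth steps, which tends to the indicator of `(s, t]` as `ε → 0+` and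
whose derivative is the difference of the mollifiers at `s` and at `t`. -/
noncomputable def smoothCutoff (s t ε r : ℝ) : ℝ :=
  Real.smoothTransition ((r - s) / ε) - Real.smoothTransition ((r - t) / ε)

theorem smoothCutoff_eq_zero {s t ε r : ℝ} (hε : 0 < ε) (hst : s ≤ t)
    (hr : r ∉ Icc s (t + ε)) : smoothCutoff s t ε r = 0 := by
  rw [mem_Icc, not_and_or, not_le, not_le] at hr
  rw [smoothCutoff]
  rcases hr with hr | hr
  · rw [Real.smoothTransition.zero_of_nonpos, Real.smoothTransition.zero_of_nonpos, sub_zero]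
    · exact div_nonpos_of_nonpos_of_nonneg (by linarith) hε.le
    · exact div_nonpos_of_nonpos_of_nonneg (by linarith) hε.le
  · rw [Real.smoothTransition.one_of_one_le, Real.smoothTransition.one_of_one_le, sub_self]
    · rw [one_le_div hε]; linarith
    · rw [one_le_div hε]; linarith

theorem abs_smoothCutoff_le (s t ε r : ℝ) : |smoothCutoff s t ε r| ≤ 1 := by
  rw [smoothCutoff, abs_le]
  constructor <;> linarith [Real.smoothTransition.nonneg ((r - s) / ε),
    Real.smoothTransition.nonneg ((r - t) / ε), Real.smoothTransition.le_one ((r - s) / ε),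
    Real.smoothTransition.le_one ((r - t) / ε)]

theorem contDiff_smoothCutoff (s t ε : ℝ) : ContDiff ℝ ∞ (smoothCutoff s t ε) :=
  (Real.smoothTransition.contDiff.comp ((contDiff_id.sub contDiff_const).div_const ε)).sub
    (Real.smoothTransition.contDiff.comp ((contDiff_id.sub contDiff_const).div_const ε))

theorem deriv_smoothCutoff (s t ε r : ℝ) :
    deriv (smoothCutoff s t ε) r = mollifier s ε r - mollifier t ε r :=
  ((hasDerivAt_smoothTransition_rescaled s ε r).sub
    (hasDerivAt_smoothTransition_rescaled t ε r)).deriv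

theorem isTestFunction_smoothCutoff {S : Set ℝ} {s t ε : ℝ} (hε : 0 < ε) (hst : s ≤ t)
    (hS : Icc s (t + ε) ⊆ S) : SwiftHohenberg.IsTestFunction S (smoothCutoff s t ε) := by
  have hsupp : Function.support (smoothCutoff s t ε) ⊆ Icc s (t + ε) := fun r hr => by
    by_contra h
    exact hr (smoothCutoff_eq_zero hε hst h)
  exact ⟨contDiff_smoothCutoff s t ε,
    HasCompactSupport.of_support_subset_isCompact isCompact_Icc hsupp,
    (closure_minimal hsupp isClosed_Icc).trans hS⟩

theorem eventually_smoothTransition_rescaled (s r : ℝ) :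
    ∀ᶠ ε in 𝓝[>] (0 : ℝ),
      Real.smoothTransition ((r - s) / ε) = (Ioi s).indicator (fun _ => 1) r := by
  by_cases hr : s < r
  · filter_upwards [Ioo_mem_nhdsGT (sub_pos.2 hr)] with ε hε
    rw [indicator_of_mem (mem_Ioi.2 hr), Real.smoothTransition.one_of_one_le]
    rw [one_le_div hε.1]
    exact hε.2.le
  · filter_upwards [self_mem_nhdsWithin] with ε hε
    rw [indicator_of_notMem (by simpa using hr), Real.smoothTransition.zero_of_nonpos]
    exact div_nonpos_of_nonpos_of_nonneg (by linarith) (le_of_lt hε)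

theorem tendsto_setIntegral_smoothCutoff_smul {g : ℝ → E} {S : Set ℝ} {s t δ : ℝ}
    (hst : s ≤ t) (hδ : 0 < δ) (hS : Icc s (t + δ) ⊆ S)
    (hg : IntegrableOn g (Icc s (t + δ))) :
    Tendsto (fun ε => ∫ r in S, smoothCutoff s t ε r • g r) (𝓝[>] 0) (𝓝 (∫ r in s..t, g r)) := by
  have key : ∀ᶠ ε in 𝓝[>] (0 : ℝ), ∫ r in S, smoothCutoff s t ε r • g r
      = ∫ r in Icc s (t + δ), smoothCutoff s t ε r • g r := by
    filter_upwards [Ioo_mem_nhdsGT hδ] with ε hε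
    have hz : ∀ r, r ∉ Icc s (t + δ) → smoothCutoff s t ε r • g r = 0 := fun r hr => by
      rw [smoothCutoff_eq_zero hε.1 hst fun h => hr ⟨h.1, by linarith [h.2, hε.2]⟩, zero_smul]
    rw [setIntegral_eq_integral_of_forall_compl_eq_zero fun r hr => hz r fun h => hr (hS h),
      setIntegral_eq_integral_of_forall_compl_eq_zero hz]
  refine Tendsto.congr' (key.mono fun _ h => h.symm) ?_
  have hlim : ∫ r in s..t, g r = ∫ r in Icc s (t + δ), (Ioc s t).indicator g r := by
    rw [setIntegral_indicator measurableSet_Ioc, inter_eq_self_of_subset_right,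
      intervalIntegral.integral_of_le hst]
    exact fun r hr => ⟨hr.1.le, by linarith [hr.2]⟩
  rw [hlim]
  refine tendsto_integral_filter_of_dominated_convergence (fun r => ‖g r‖) ?_ ?_ hg.norm ?_
  · exact Eventually.of_forall fun ε =>
      (contDiff_smoothCutoff s t ε).continuous.aestronglyMeasurable.smul hg.aestronglyMeasurable
  · refine Eventually.of_forall fun ε => Eventually.of_forall fun r => ?_
    rw [norm_smul]
    exact mul_le_of_le_one_left (norm_nonneg _) (abs_smoothCutoff_le s t ε r)
  · refine Eventually.of_forall fun r => tendsto_nhds_of_eventually_eq ?_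
    filter_upwards [eventually_smoothTransition_rescaled s r,
      eventually_smoothTransition_rescaled t r] with ε h1 h2
    rw [smoothCutoff, h1, h2]
    by_cases hs : s < r
    · by_cases ht : t < r
      · simp [hs, ht]
      · simp [hs, ht, not_lt.1 ht]
    · have ht : ¬ t < r := fun h => hs (hst.trans_lt h)
      simp [hs, ht]

/-- A continuous function with a locally integrable weak derivative is the integral of that
derivative: test with `smoothCutoff s t ε` and let `ε → 0+`. -/
theorem sub_eq_integral_of_weakDeriv [CompleteSpace E] {u g : ℝ → E} {S : Set ℝ}
    (hSo : IsOpen S) (hu : ContinuousOn u S) (hg : LocallyIntegrableOn g S)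
    (h : ∀ φ : ℝ → ℝ, SwiftHohenberg.IsTestFunction S φ →
      ∫ r in S, deriv φ r • u r = -∫ r in S, φ r • g r)
    {s t : ℝ} (hst : s ≤ t) (hS : Icc s t ⊆ S) :
    u t - u s = ∫ r in s..t, g r := by
  obtain ⟨δ, hδ, hδS⟩ : ∃ δ > 0, Icc s (t + δ) ⊆ S := by
    obtain ⟨η, hη, hηS⟩ := Metric.isOpen_iff.1 hSo t (hS ⟨hst, le_rfl⟩)
    refine ⟨η / 2, half_pos hη, fun r hr => ?_⟩
    rcases le_total r t with h' | h'
    · exact hS ⟨hr.1, h'⟩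
    · refine hηS ?_
      rw [Metric.mem_ball, Real.dist_eq, abs_of_nonneg (by linarith)]
      linarith [hr.2]
  have hsub : Icc s (s + δ) ⊆ Icc s (t + δ) := Icc_subset_Icc_right (by linarith)
  have htub : Icc t (t + δ) ⊆ Icc s (t + δ) := Icc_subset_Icc_left hst
  have h1 := (tendsto_setIntegral_mollifier_smul hδ (hsub.trans hδS)
    (hu.mono (hsub.trans hδS))).sub
    (tendsto_setIntegral_mollifier_smul hδ (htub.trans hδS) (hu.mono (htub.trans hδS)))
  have h2 := (tendsto_setIntegral_smoothCutoff_smul hst hδ hδS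
    (hg.integrableOn_compact_subset hδS isCompact_Icc)).neg
  have heq : ∀ᶠ ε in 𝓝[>] (0 : ℝ),
      (∫ r in S, mollifier s ε r • u r) - ∫ r in S, mollifier t ε r • u r
        = -∫ r in S, smoothCutoff s t ε r • g r := by
    filter_upwards [Ioo_mem_nhdsGT hδ] with ε hε
    have hεS : Icc s (t + ε) ⊆ S := (Icc_subset_Icc_right (by linarith [hε.2])).trans hδS
    rw [← h _ (isTestFunction_smoothCutoff hε.1 hst hεS), ← integral_sub
      (integrableOn_mollifier_smul hε.1 (hu.mono ((Icc_subset_Icc_right (by linarith)).trans hεS)))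
      (integrableOn_mollifier_smul hε.1 (hu.mono ((Icc_subset_Icc_left hst).trans hεS)))]
    simp only [deriv_smoothCutoff, sub_smul]
  rw [← neg_sub, tendsto_nhds_unique (h1.congr' heq) h2, neg_neg]

end WeakDerivative

/-! ### Bounds and integrability for solutions -/

namespace SwiftHohenberg

variable {d : ℕ} {O : Set (EuclideanSpace ℝ (Fin d))}

/-- The weak derivative of order zero is the function itself, by uniqueness of weak derivatives on
open sets (the fundamental lemma of the calculus of variations). -/
theorem weakDeriv_zero_order (hO : IsOpen O) (I : Fin 0 → Fin d) (w : L2 O) :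
    weakDeriv O I w = w := by
  have hw : IsWeakDeriv O I w w := fun φ _ => by simp [partialDeriv]
  have hex : ∃ v, IsWeakDeriv O I w v := ⟨w, hw⟩
  have hv : IsWeakDeriv O I w (weakDeriv O I w) := by
    rw [weakDeriv, dif_pos hex]
    exact hex.choose_spec
  set v := weakDeriv O I w
  have hloc : ∀ z : L2 O, LocallyIntegrableOn (z : EuclideanSpace ℝ (Fin d) → ℝ) O := fun z =>
    locallyIntegrableOn_of_locallyIntegrable_restrict ((Lp.memLp z).locallyIntegrable (by norm_num))
  have hae : ∀ᵐ x, x ∈ O → (v - w : EuclideanSpace ℝ (Fin d) → ℝ) x = 0 := by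
    refine hO.ae_eq_zero_of_integral_contDiff_smul_eq_zero ((hloc v).sub (hloc w)) ?_
    intro φ h1 h2 h3
    have e := (hv φ ⟨h1, h2, h3⟩).symm.trans (hw φ ⟨h1, h2, h3⟩)
    have hint : ∀ z : L2 O, IntegrableOn (fun x => z x * φ x) O := by
      intro z
      have hb : MemLp φ 2 (volume.restrict O) := (h1.continuous.memLp_of_hasCompactSupport h2)
      exact (Lp.memLp z).integrable_mul hb
    simp only [pow_zero, one_mul] at e
    have hz : ∀ x, x ∉ O → φ x • (v - w : EuclideanSpace ℝ (Fin d) → ℝ) x = 0 := fun x hx => by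
      rw [image_eq_zero_of_notMem_tsupport fun h => hx (h3 h), zero_smul]
    rw [← setIntegral_eq_integral_of_forall_compl_eq_zero hz]
    have : ∀ x, φ x • (v - w : EuclideanSpace ℝ (Fin d) → ℝ) x = v x * φ x - w x * φ x := by
      intro x; simp only [Pi.sub_apply, smul_eq_mul]; ring
    simp only [this]
    rw [integral_sub (hint v) (hint w), e, sub_self]
  refine Lp.ext ?_
  filter_upwards [(ae_restrict_iff' hO.measurableSet).2 hae] with x hx
  exact sub_eq_zero.1 hx

theorem norm_le_sobolevNorm (hO : IsOpen O) (k : ℕ) (w : L2 O) : ‖w‖ ≤ sobolevNorm O k w := by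
  refine Real.le_sqrt_of_sq_le ?_
  have h0 : ∑ I : Fin 0 → Fin d, ‖weakDeriv O I w‖ ^ 2 = ‖w‖ ^ 2 := by
    simp [weakDeriv_zero_order hO]
  rw [← h0]
  exact Finset.single_le_sum (f := fun j => ∑ I : Fin j → Fin d, ‖weakDeriv O I w‖ ^ 2)
    (fun j _ => Finset.sum_nonneg fun _ _ => sq_nonneg _) (Finset.mem_range.2 k.succ_pos)

variable {a n : ℝ} {T : EReal} {u₀ : L2 O} {u : ℝ → L2 O}

theorem IsSolution.continuousOn (hu : IsSolution O a n T u₀ u) (hO : IsOpen O) :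
    ContinuousOn u {s : ℝ | 0 ≤ s ∧ (s : EReal) < T} := by
  intro t ht
  rw [ContinuousWithinAt, tendsto_iff_norm_sub_tendsto_zero]
  exact squeeze_zero (fun _ => norm_nonneg _) (fun s => norm_le_sobolevNorm hO 2 _)
    (hu.continuous_V t ht.1 ht.2)

theorem IsSolution.integrableOn_drift (hu : IsSolution O a n T u₀ u) (hO : IsOpen O) {t : ℝ}
    (ht : 0 < t) (htT : (t : EReal) < T) :
    IntegrableOn (fun s => drift O a n (u s)) (Ioo 0 t) := by
  have hd : ∀ j ≤ 4, ∀ I : Fin j → Fin d,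
      Integrable (fun s => weakDeriv O I (u s)) (volume.restrict (Ioo 0 t)) := fun j hj I =>
    (hu.memLp_E t ht htT j hj I).integrable (by norm_num)
  have h0 : Integrable u (volume.restrict (Ioo 0 t)) := by
    simpa only [weakDeriv_zero_order hO] using hd 0 (by norm_num) Fin.elim0
  have hl : Integrable (fun s => laplacian O (u s)) (volume.restrict (Ioo 0 t)) :=
    integrable_finsetSum _ fun i _ => hd 2 (by norm_num) _
  have hb : Integrable (fun s => bilaplacian O (u s)) (volume.restrict (Ioo 0 t)) :=
    integrable_finsetSum _ fun i _ => integrable_finsetSum _ fun j _ => hd 4 le_rfl _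
  exact ((hb.neg.add (hl.smul (2 : ℝ))).sub (h0.smul a)).sub (hu.pow_integrable t ht htT)

theorem IsSolution.integrableOn_proj_drift (hu : IsSolution O a n T u₀ u) (hO : IsOpen O) {t : ℝ}
    (ht : 0 < t) (htT : (t : EReal) < T) :
    IntegrableOn (fun s => proj O (u s) (drift O a n (u s))) (Ioo 0 t) := by
  have hf := hu.integrableOn_drift hO ht htT
  have hc : ContinuousOn u (Icc 0 t) := (hu.continuousOn hO).mono fun s hs =>
    ⟨hs.1, (EReal.coe_le_coe_iff.2 hs.2).trans_lt htT⟩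
  obtain ⟨C, hC⟩ := isCompact_Icc.exists_bound_of_continuousOn hc
  have hum : AEStronglyMeasurable u (volume.restrict (Ioo 0 t)) :=
    (hc.mono Ioo_subset_Icc_self).aestronglyMeasurable measurableSet_Ioo
  refine hf.sub ((hf.norm.const_mul (C * C)).mono'
    ((hf.aestronglyMeasurable.inner (𝕜 := ℝ) hum).smul hum) ?_)
  filter_upwards [ae_restrict_mem measurableSet_Ioo] with s hs
  have hCs := hC s (Ioo_subset_Icc_self hs)
  rw [norm_smul]
  calc _ ≤ (‖drift O a n (u s)‖ * ‖u s‖) * ‖u s‖ := by gcongr; exact norm_inner_le_norm _ _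
    _ ≤ (‖drift O a n (u s)‖ * C) * C := by
      gcongr
      exact mul_nonneg (norm_nonneg _) ((norm_nonneg _).trans hCs)
    _ = C * C * ‖drift O a n (u s)‖ := by ring

/-- The integrated equation. The test functions of the weak equation are supported away from time
`0`, so the initial time is reached by continuity. -/
theorem IsSolution.eq_add_integral (hu : IsSolution O a n T u₀ u) (hO : IsOpen O) {t : ℝ}
    (ht : 0 < t) (htT : (t : EReal) < T) :
    u t = u 0 + ∫ r in 0..t, proj O (u r) (drift O a n (u r)) := by
  set S : Set ℝ := {s : ℝ | 0 < s ∧ (s : EReal) < T}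
  have hSo : IsOpen S :=
    isOpen_Ioi.inter (isOpen_Iio.preimage continuous_coe_real_ereal)
  have hg : LocallyIntegrableOn (fun r => proj O (u r) (drift O a n (u r))) S := by
    intro r hr
    obtain ⟨q, hrq, hqT⟩ := EReal.exists_between_coe_real hr.2
    have hrq' : r < q := EReal.coe_lt_coe_iff.1 hrq
    exact ⟨Ioo 0 q, mem_nhdsWithin_of_mem_nhds (Ioo_mem_nhds hr.1 hrq'),
      hu.integrableOn_proj_drift hO (hr.1.trans hrq') hqT⟩
  have hci : IntervalIntegrable (fun r => proj O (u r) (drift O a n (u r))) volume 0 t := by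
    rw [intervalIntegrable_iff_integrableOn_Ioo_of_le ht.le]
    exact hu.integrableOn_proj_drift hO ht htT
  have hIcc : Icc 0 t ⊆ {s : ℝ | 0 ≤ s ∧ (s : EReal) < T} := fun s hs =>
    ⟨hs.1, (EReal.coe_le_coe_iff.2 hs.2).trans_lt htT⟩
  have heq : ∀ᶠ s in 𝓝[>] (0 : ℝ),
      u t - u s = ∫ r in s..t, proj O (u r) (drift O a n (u r)) := by
    filter_upwards [Ioo_mem_nhdsGT ht] with s hs
    exact sub_eq_integral_of_weakDeriv hSo ((hu.continuousOn hO).mono fun r hr => ⟨hr.1.le, hr.2⟩)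
      hg hu.equation hs.2.le fun r hr =>
        ⟨hs.1.trans_le hr.1, (EReal.coe_le_coe_iff.2 hr.2).trans_lt htT⟩
  have hle : 𝓝[>] (0 : ℝ) ≤ 𝓝[Icc 0 t] 0 := by
    rw [← nhdsWithin_Ioo_eq_nhdsGT ht]
    exact nhdsWithin_mono _ Ioo_subset_Icc_self
  have h1 : Tendsto (fun s => u t - u s) (𝓝[>] 0) (𝓝 (u t - u 0)) :=
    tendsto_const_nhds.sub
      ((((hu.continuousOn hO).mono hIcc) 0 (by simp [ht.le])).tendsto.mono_left hle)
  have h2 : Tendsto (fun s => ∫ r in s..t, proj O (u r) (drift O a n (u r))) (𝓝[>] 0)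
      (𝓝 (∫ r in 0..t, proj O (u r) (drift O a n (u r)))) := by
    have hc := intervalIntegral.continuousOn_primitive_interval_left (a := 0) (b := t) (μ := volume)
      ((intervalIntegrable_iff_integrableOn_Icc_of_le ht.le).1 hci |>.mono_set (uIcc_of_le ht.le).le)
    rw [uIcc_of_le ht.le] at hc
    exact (hc 0 (by simp [ht.le])).tendsto.mono_left hle
  rw [← tendsto_nhds_unique (h1.congr' heq) h2, add_sub_cancel]

end SwiftHohenberg

theorem proposition5p3 {d : ℕ} (O : Set (EuclideanSpace ℝ (Fin d))) (hO : IsOpen O)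
    (a n : ℝ) (hn : 1 / 2 < n) (T : EReal)
    (u₀ : SwiftHohenberg.L2 O) (u : ℝ → SwiftHohenberg.L2 O)
    (hu : SwiftHohenberg.IsSolution O a n T u₀ u)
    (hu₀ : u₀ ∈ SwiftHohenberg.manifold O) :
    ∀ t : ℝ, 0 ≤ t → (t : EReal) < T → u t ∈ SwiftHohenberg.manifold O := by
  intro t ht htT
  rcases ht.eq_or_lt with rfl | ht0
  · rwa [hu.initial]
  have hlt : ∀ r ∈ Icc 0 t, (r : EReal) < T := fun r hr =>
    (EReal.coe_le_coe_iff.2 hr.2).trans_lt htT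
  have h0 : ‖u 0‖ = 1 := by
    rw [hu.initial]
    exact (pow_eq_one_iff_of_nonneg (norm_nonneg u₀) two_ne_zero).1 hu₀
  have ht1 : ‖u t‖ = 1 := by
    refine norm_eq_one_of_eq_integral_tangential (f := fun r => SwiftHohenberg.drift O a n (u r))
      ht ((hu.continuousOn hO).mono fun r hr => ⟨hr.1, hlt r hr⟩)
      ((intervalIntegrable_iff_integrableOn_Ioo_of_le ht).2 (hu.integrableOn_drift hO ht0 htT))
      (fun r hr => ?_) h0
    rcases hr.1.eq_or_lt with rfl | hr0
    · simp
    · exact hu.eq_add_integral hO hr0 (hlt r hr)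
  change ‖u t‖ ^ 2 = 1
  rw [ht1, one_pow]
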